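/- All spaces are Tychonoff (completely regular Hausdorff). A space $X$ is productively Lindelöf if $X\times Y$ is Lindelöf for every Lindelöf space $Y$; it is Čech-complete if it is a $G_\delta$ subset of its Stone–Čech compactification $\beta X$. A Michael space is a Lindelöf space $M$ such that the product $M\times\mathbb{P}$ is not Lindelöf, where $\mathbb{P}$ is the space of irrational numbers with the topology inherited from $\mathbb{R}$. Theorem. There exists a Michael space if and only if every productively Lindelöf Čech-complete space is $\sigma$-compact. -/

import Mathlib

universe u

/-- The space of irrational numbers, with the subspace topology inherited from the real line. -/
abbrev Irrationals : Type := {x : ℝ // Irrational x}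

/-- `X` is productively Lindelöf: its product with every Lindelöf space is Lindelöf.
"Space" means Tychonoff (completely regular Hausdorff) space. -/
def ProductivelyLindelof (X : Type u) [TopologicalSpace X] : Prop :=
  ∀ (Y : Type u) [TopologicalSpace Y], T35Space Y → LindelofSpace Y → LindelofSpace (X × Y)

/-- A Michael space: a Lindelöf (Tychonoff) space whose product with the space of irrationals
is not Lindelöf. -/
structure IsMichaelSpace (M : Type u) [TopologicalSpace M] : Prop where
  t35Space : T35Space M
  lindelofSpace : LindelofSpace M
  not_lindelofSpace_prod : ¬ LindelofSpace (M × Irrationals)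

/-- A Čech-complete space: a Tychonoff space that is a `Gδ` subset of its Stone–Čech
compactification. -/
structure IsCechComplete (X : Type u) [TopologicalSpace X] : Prop where
  t35Space : T35Space X
  isGδ_range : IsGδ (Set.range (stoneCechUnit : X → StoneCech X))

/-!
If every productively Lindelöf Čech-complete space is `σ`-compact, then the space of irrationals,
which is Čech-complete but not `σ`-compact, is not productively Lindelöf, and any Lindelöf space
witnessing this is a Michael space.

Conversely, let `X` be productively Lindelöf and Čech-complete but not `σ`-compact, and let `M` be
any Lindelöf Tychonoff space; it is shown that `M × Irrationals` is Lindelöf. Being Lindelöf and a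
`Gδ` set in `βX`, the space `X` is a countable intersection of cozero sets of `βX`. The reciprocals
of the functions defining these form a map `h : X → [0, ∞)^ℕ` that is proper
(`IsCechComplete.exists_continuous_isCompact_box`). A finite sequence `t` of natural numbers
determines the closed cell of points whose first coordinates under `h` lie in the unit intervals
`[t i, t i + 1]`. Since `X` is not `σ`-compact, the sequences whose cells are not `σ`-compact form a
tree in which every node has an infinitely splitting extension
(`exists_infinitely_splitting_extension`); this is the combinatorial core of Hurewicz's theorem on
closed copies of the Baire space. Such a tree yields a relation `R ⊆ X × ℕ^ℕ` that projects properly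
to `X` and onto `ℕ^ℕ` (`exists_proper_relation`). The Lindelöf property passes from `X × M` to
`R × M` along the proper projection (`IsProperMap.lindelofSpace`), and then to `ℕ^ℕ × M` and
`M × Irrationals` as continuous images. Working with a relation instead of a closed copy of `ℕ^ℕ`
avoids having to make the cells disjoint.
-/

open Set Filter Topology

/-! ### Lindelöf spaces and proper maps -/

/-- Properness lifts cluster points of the image filter, and the image of a filter with the countable
intersection property again has that property. -/
theorem IsProperMap.lindelofSpace {X Y : Type*} [TopologicalSpace X] [TopologicalSpace Y]
    {f : X → Y} (hf : IsProperMap f) [LindelofSpace Y] : LindelofSpace X := by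
  refine ⟨fun F _ _ _ => ?_⟩
  have : (Filter.map f F).NeBot := inferInstance
  obtain ⟨y, -, hy⟩ := isLindelof_univ (X := Y) (f := Filter.map f F) (by simp)
  obtain ⟨x, -, hx⟩ := hf.clusterPt_of_mapClusterPt hy
  exact ⟨x, mem_univ x, hx⟩

/-! ### Cells of a sequence of real functions -/

section Cells

variable {X : Type*}

/-- The cell of a finite sequence `t` of natural numbers, listed with the last entry first: the
points `x` such that, for each `i < t.length`, the value `h x i` lies in `[a, a + 1]`, where `a` is
the entry of `t` in position `i`, counted from the end of the list. -/
def cell (h : X → ℕ → ℝ) : List ℕ → Set X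
  | [] => univ
  | a :: t => cell h t ∩ {x | (a : ℝ) ≤ h x t.length ∧ h x t.length ≤ a + 1}

variable {h : X → ℕ → ℝ}

theorem cell_subset_of_suffix {s t : List ℕ} (hst : s <:+ t) : cell h t ⊆ cell h s := by
  obtain ⟨r, rfl⟩ := hst
  induction r with
  | nil => exact subset_rfl
  | cons a r ih => exact inter_subset_left.trans ih

theorem exists_bound_on_cell (h : X → ℕ → ℝ) (t : List ℕ) {i : ℕ} (hi : i < t.length) :
    ∃ c : ℝ, ∀ x ∈ cell h t, h x i ≤ c := by
  induction t with
  | nil => simp at hi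
  | cons a t ih =>
    rcases Nat.lt_succ_iff_lt_or_eq.1 hi with hi | rfl
    · obtain ⟨c, hc⟩ := ih hi
      exact ⟨c, fun x hx => hc x hx.1⟩
    · exact ⟨a + 1, fun x hx => hx.2.2⟩

theorem mem_cell_floor_cons {t : List ℕ} {x : X} (h0 : 0 ≤ h x t.length) (hx : x ∈ cell h t) :
    x ∈ cell h (⌊h x t.length⌋₊ :: t) :=
  ⟨hx, Nat.floor_le h0, (Nat.lt_floor_add_one _).le⟩

variable [TopologicalSpace X]

theorem isClosed_cell (hc : Continuous h) (t : List ℕ) : IsClosed (cell h t) := by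
  have hc' : ∀ i, Continuous fun x => h x i := fun i => (continuous_apply i).comp hc
  induction t with
  | nil => exact isClosed_univ
  | cons a t ih =>
    exact ih.inter ((isClosed_le continuous_const (hc' _)).inter
      (isClosed_le (hc' _) continuous_const))

/-- A finite sequence whose cell is not `σ`-compact extends to one that has infinitely many
one-step extensions with non-`σ`-compact cells. Otherwise, the points of the cell that lie in no
`σ`-compact smaller cell would follow a finitely branching tree, hence lie in a compact box. -/
theorem exists_infinitely_splitting_extension (hc : Continuous h) (h0 : ∀ x i, 0 ≤ h x i)
    (hbox : ∀ b : ℕ → ℝ, IsCompact {x | ∀ i, h x i ≤ b i}) {t : List ℕ}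
    (ht : ¬ IsSigmaCompact (cell h t)) :
    ∃ s, t <:+ s ∧ ∀ n, ∃ v ≥ n, ¬ IsSigmaCompact (cell h (v :: s)) := by
  by_contra! H
  have H' : ∀ s, ∃ n, t <:+ s → ∀ v ≥ n, IsSigmaCompact (cell h (v :: s)) := fun s => by
    by_cases hs : t <:+ s
    · exact (H s hs).imp fun n hn _ => hn
    · exact ⟨0, fun h => absurd h hs⟩
  choose N hN using H'
  set A : Set X := {x ∈ cell h t | ∀ s, IsSigmaCompact (cell h s) → x ∉ cell h s} with hA
  have level : ∀ k, ∃ L : Finset (List ℕ),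
      ∀ x ∈ A, ∃ s ∈ L, t <:+ s ∧ s.length = t.length + k ∧ x ∈ cell h s := by
    intro k
    induction k with
    | zero => exact ⟨{t}, fun x hx => ⟨t, by simp, List.suffix_rfl, rfl, hx.1⟩⟩
    | succ k ih =>
      obtain ⟨L, hL⟩ := ih
      refine ⟨L.biUnion fun s => (Finset.range (N s)).image fun v => v :: s, fun x hx => ?_⟩
      obtain ⟨s, hsL, hts, hlen, hxs⟩ := hL x hx
      have hxs' := mem_cell_floor_cons (h0 x _) hxs
      have hlt : ⌊h x s.length⌋₊ < N s := by
        by_contra! hle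
        exact hx.2 _ (hN s hts _ hle) hxs'
      refine ⟨_, ?_, hts.trans (List.suffix_cons _ _), ?_, hxs'⟩
      · simp only [Finset.mem_biUnion, Finset.mem_image, Finset.mem_range]
        exact ⟨s, hsL, _, hlt, rfl⟩
      · simp [hlen, add_assoc]
  have bound : ∀ i, ∃ c : ℝ, ∀ x ∈ A, h x i ≤ c := by
    intro i
    obtain ⟨L, hL⟩ := level (i + 1)
    have : ∀ s : List ℕ, ∃ c : ℝ, i < s.length → ∀ x ∈ cell h s, h x i ≤ c := fun s => by
      by_cases hi : i < s.length
      · exact (exists_bound_on_cell h s hi).imp fun c hc _ => hc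
      · exact ⟨0, fun h => absurd h hi⟩
    choose c hc using this
    obtain ⟨C, hC⟩ := (L.image c).exists_le
    refine ⟨C, fun x hx => ?_⟩
    obtain ⟨s, hsL, -, hlen, hxs⟩ := hL x hx
    exact (hc s (by omega) x hxs).trans (hC _ (Finset.mem_image_of_mem c hsL))
  choose b hb using bound
  have hcover : IsSigmaCompact
      ({x | ∀ i, h x i ≤ b i} ∪ ⋃ s : {s // IsSigmaCompact (cell h s)}, cell h s.1) := by
    rw [union_eq_iUnion]
    refine isSigmaCompact_iUnion _ fun i => ?_
    cases i
    · exact isSigmaCompact_iUnion _ fun s => s.2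
    · exact (hbox b).isSigmaCompact
  refine ht (hcover.of_isClosed_subset (isClosed_cell hc t) fun x hx => ?_)
  by_cases hxA : x ∈ A
  · exact Or.inl fun i => hb i x hxA
  · simp only [hA, mem_ofPred_eq, not_and, not_forall, not_not] at hxA
    obtain ⟨s, hs, hxs⟩ := hxA hx
    exact Or.inr (mem_iUnion.2 ⟨⟨s, hs⟩, hxs⟩)

/-- A scheme of finite sequences indexed by the Baire space: `e φ k` depends only on the first `k`
values of `φ`, it is strictly extended by `e φ (k + 1)`, the first new entry being at least `φ k`,
and all its cells fail to be `σ`-compact. -/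
theorem exists_scheme (hc : Continuous h) (h0 : ∀ x i, 0 ≤ h x i)
    (hbox : ∀ b : ℕ → ℝ, IsCompact {x | ∀ i, h x i ≤ b i}) (hX : ¬ SigmaCompactSpace X) :
    ∃ e : (ℕ → ℕ) → ℕ → List ℕ,
      (∀ φ ψ k, (∀ i < k, φ i = ψ i) → e φ k = e ψ k) ∧
      (∀ φ k, ∃ v ≥ φ k, (v :: e φ k) <:+ e φ (k + 1)) ∧
      ∀ φ k, ¬ IsSigmaCompact (cell h (e φ k)) := by
  set D := {s : List ℕ // ¬ IsSigmaCompact (cell h s) ∧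
    ∀ n, ∃ v ≥ n, ¬ IsSigmaCompact (cell h (v :: s))} with hD
  have ext : ∀ t, ¬ IsSigmaCompact (cell h t) → ∃ s : D, t <:+ s.1 := by
    intro t ht
    obtain ⟨s, hts, hs⟩ := exists_infinitely_splitting_extension hc h0 hbox ht
    refine ⟨⟨s, fun hs' => ?_, hs⟩, hts⟩
    obtain ⟨v, -, hv⟩ := hs 0
    exact hv (hs'.of_isClosed_subset (isClosed_cell hc _) inter_subset_left)
  have step : ∀ (s : D) (n : ℕ), ∃ s' : D, ∃ v ≥ n, (v :: s.1) <:+ s'.1 := by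
    intro s n
    obtain ⟨v, hvn, hv⟩ := s.2.2 n
    obtain ⟨s', hs'⟩ := ext _ hv
    exact ⟨s', v, hvn, hs'⟩
  choose next hnext using step
  obtain ⟨r, -⟩ := ext [] (by simpa [cell, isSigmaCompact_univ_iff] using hX)
  let e : (ℕ → ℕ) → ℕ → D := fun φ k => Nat.rec r (fun j s => next s (φ j)) k
  refine ⟨fun φ k => (e φ k).1, fun φ ψ k hk => ?_, fun φ k => hnext (e φ k) (φ k),
    fun φ k => (e φ k).2.1⟩
  suffices e φ k = e ψ k from congrArg Subtype.val this
  induction k with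
  | zero => rfl
  | succ k ih =>
    change next (e φ k) (φ k) = next (e ψ k) (ψ k)
    rw [ih fun i hi => hk i (by omega), hk k (by omega)]

/-- If `h : X → [0, ∞)^ℕ` is continuous with compact preimages of boxes and `X` is not
`σ`-compact, then there is a relation between `X` and the Baire space that projects properly to `X`
and onto the Baire space. It relates `x` to `φ` when `x` lies in all cells of the scheme along
`φ`. -/
theorem exists_proper_relation (hc : Continuous h) (h0 : ∀ x i, 0 ≤ h x i)
    (hbox : ∀ b : ℕ → ℝ, IsCompact {x | ∀ i, h x i ≤ b i}) (hX : ¬ SigmaCompactSpace X) :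
    ∃ R : Set (X × (ℕ → ℕ)), IsProperMap (fun p : R => p.1.1) ∧
      Function.Surjective (fun p : R => p.1.2) := by
  obtain ⟨e, he_loc, he_succ, he⟩ := exists_scheme hc h0 hbox hX
  have he_anti : ∀ φ k, cell h (e φ (k + 1)) ⊆ cell h (e φ k) := fun φ k => by
    obtain ⟨v, -, hv⟩ := he_succ φ k
    exact cell_subset_of_suffix ((List.suffix_cons _ _).trans hv)
  have he_len : ∀ φ k, k ≤ (e φ k).length := fun φ k => by
    induction k with
    | zero => exact Nat.zero_le _
    | succ k ih =>
      obtain ⟨v, -, hv⟩ := he_succ φ k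
      have := hv.length_le
      simp only [List.length_cons] at this
      omega
  have he_val : ∀ φ k, ∀ x ∈ cell h (e φ (k + 1)), (φ k : ℝ) ≤ h x (e φ k).length := by
    intro φ k x hx
    obtain ⟨v, hvk, hv⟩ := he_succ φ k
    exact (Nat.cast_le.2 hvk).trans (cell_subset_of_suffix hv hx).2.1
  set R : Set (X × (ℕ → ℕ)) := {p | ∀ k, p.1 ∈ cell h (e p.2 k)}
  refine ⟨R, ?_, fun φ => ?_⟩
  · refine isProperMap_iff_ultrafilter.2 ⟨by fun_prop, fun U x hU => ?_⟩
    -- Along the ultrafilter, each value of the second coordinate is bounded, hence constant.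
    have hconst : ∀ k, ∀ ψ : ℕ → ℕ, (∀ i < k, ∀ᶠ p : R in U, p.1.2 i = ψ i) →
        ∃ a, ∀ᶠ p : R in U, p.1.2 k = a := by
      intro k ψ hψ
      have hψ' : ∀ᶠ p : R in U, ∀ i < k, p.1.2 i = ψ i := by
        simpa using (Filter.eventually_all_finite (finite_lt_nat k)).2 hψ
      have hlim : Tendsto (fun p : R => h p.1.1 (e ψ k).length) U (𝓝 (h x (e ψ k).length)) :=
        (((continuous_apply _).comp hc).tendsto x).comp hU
      obtain ⟨c, hc⟩ := exists_nat_gt (h x (e ψ k).length)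
      have hlt : ∀ᶠ p : R in U, p.1.2 k ∈ Iio c := by
        filter_upwards [hψ', hlim.eventually (gt_mem_nhds hc)] with p hp hpc
        have h1 := he_val p.1.2 k p.1.1 (p.2 (k + 1))
        rw [he_loc _ ψ k hp] at h1
        exact_mod_cast h1.trans_lt hpc
      have := (Ultrafilter.eventually_exists_mem_iff (f := U) (finite_Iio c)
        (P := fun a p => p.1.2 k = a)).1 (hlt.mono fun p hp => ⟨_, hp, rfl⟩)
      obtain ⟨a, -, ha⟩ := this
      exact ⟨a, ha⟩
    have hall : ∀ k, ∃ a, ∀ᶠ p : R in U, p.1.2 k = a := by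
      intro k
      induction k using Nat.strong_induction_on with
      | _ k ih =>
        choose! ψ hψ using ih
        exact hconst k ψ hψ
    choose φ hφ using hall
    have hmem : (x, φ) ∈ R := by
      intro k
      refine (isClosed_cell hc _).mem_of_tendsto hU ?_
      have : ∀ᶠ p : R in U, ∀ i < k, p.1.2 i = φ i := by
        simpa using (Filter.eventually_all_finite (finite_lt_nat k)).2 fun i _ => hφ i
      filter_upwards [this] with p hp
      exact he_loc _ φ k hp ▸ p.2 k
    refine ⟨⟨(x, φ), hmem⟩, rfl, ?_⟩
    rw [nhds_subtype_eq_comap, ← tendsto_iff_comap, nhds_prod_eq]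
    refine hU.prodMk (tendsto_pi_nhds.2 fun i => ?_)
    exact tendsto_nhds_of_eventually_eq (hφ i)
  · have hne : ∀ k, (cell h (e φ k)).Nonempty := fun k => by
      by_contra hemp
      rw [not_nonempty_iff_eq_empty] at hemp
      exact he φ k (hemp ▸ isSigmaCompact_empty)
    choose y hy using hne
    have anti : Antitone fun k => cell h (e φ k) := antitone_nat_of_succ_le (he_anti φ)
    -- The points `y k` lie in a common box, since all but finitely many of them lie in a cell on
    -- which a given coordinate is bounded.
    have hbdd : ∀ i, ∃ b : ℝ, ∀ k, h (y k) i ≤ b := by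
      intro i
      obtain ⟨c, hc⟩ := exists_bound_on_cell h (e φ (i + 1)) (i := i) (he_len φ (i + 1))
      obtain ⟨d, hd⟩ := ((Finset.range (i + 1)).image fun k => h (y k) i).exists_le
      refine ⟨max c d, fun k => ?_⟩
      rcases lt_or_ge k (i + 1) with hk | hk
      · exact le_max_of_le_right (hd _ (Finset.mem_image_of_mem _ (Finset.mem_range.2 hk)))
      · exact le_max_of_le_left (hc _ (anti hk (hy k)))
    choose b hb using hbdd
    have hclosed : IsClosed {x | ∀ i, h x i ≤ b i} := by
      simp only [ofPred_forall]
      exact isClosed_iInter fun i =>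
        isClosed_le ((continuous_apply i).comp hc) continuous_const
    obtain ⟨x, hx⟩ := IsCompact.nonempty_iInter_of_sequence_nonempty_isCompact_isClosed
      (fun k => cell h (e φ k) ∩ {x | ∀ i, h x i ≤ b i})
      (fun k => inter_subset_inter_left _ (he_anti φ k))
      (fun k => ⟨y k, hy k, fun i => hb i k⟩)
      ((hbox b).inter_left (isClosed_cell hc _))
      (fun k => (isClosed_cell hc _).inter hclosed)
    exact ⟨⟨(x, φ), fun k => (mem_iInter.1 hx k).1⟩, rfl⟩

end Cells

/-! ### Čech-complete Lindelöf spaces -/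

/-- In a compact Hausdorff space, a Lindelöf subset of an open set is separated from the complement
by a cozero set. -/
theorem IsLindelof.exists_continuous_pos_subset {C : Type*} [TopologicalSpace C] [CompactSpace C]
    [T2Space C] {s U : Set C} (hs : IsLindelof s) (hU : IsOpen U) (hsU : s ⊆ U) :
    ∃ g : C → ℝ, Continuous g ∧ (∀ y, 0 ≤ g y) ∧ (∀ y ∈ s, 0 < g y) ∧ ∀ y, 0 < g y → y ∈ U := by
  have key : ∀ x : C, ∃ f : C(C, ℝ), (∀ y, f y ∈ Icc (0 : ℝ) 1) ∧ (∀ y ∉ U, f y = 0) ∧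
      (x ∈ s → 0 < f x) := by
    intro x
    by_cases hx : x ∈ s
    · obtain ⟨f, hf0, hf1, hf⟩ := exists_continuous_zero_one_of_isClosed hU.isClosed_compl
        (isClosed_singleton (x := x)) (disjoint_singleton_right.2 fun h => h (hsU hx))
      exact ⟨f, hf, fun y hy => hf0 hy, fun _ => by simp [hf1 (mem_singleton x)]⟩
    · exact ⟨0, fun y => by simp, fun y _ => rfl, fun h => absurd h hx⟩
  choose f hf01 hf0 hfpos using key
  obtain ⟨r, hr, hrs, hcov⟩ := hs.elim_nhds_subcover (fun x => {y | 0 < f x y})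
    fun x hx => (f x).continuous.continuousAt.eventually (lt_mem_nhds (hfpos x hx))
  obtain ⟨w, hw, c, hwc, -⟩ := hr.exists_pos_hasSum_le one_pos
  have hle : ∀ (x : r) (y : C), w x * f x y ≤ w x := fun x y =>
    mul_le_of_le_one_right (hw x).le (hf01 x y).2
  have hnn : ∀ (x : r) (y : C), 0 ≤ w x * f x y := fun x y => mul_nonneg (hw x).le (hf01 x y).1
  have hsum : ∀ y, Summable fun x : r => w x * f x y := fun y =>
    hwc.summable.of_nonneg_of_le (fun x => hnn x y) fun x => hle x y
  refine ⟨fun y => ∑' x : r, w x * f x y,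
    continuous_tsum (fun x => (f x).continuous.const_mul _) hwc.summable fun x y => ?_,
    fun y => tsum_nonneg fun x => hnn x y, fun y hy => ?_, fun y hy => ?_⟩
  · rw [Real.norm_of_nonneg (hnn x y)]
    exact hle x y
  · obtain ⟨x, hx, hxy⟩ := mem_iUnion₂.1 (hcov hy)
    exact (hsum y).tsum_pos (fun x => hnn x y) ⟨x, hx⟩ (mul_pos (hw x) hxy)
  · by_contra hyU
    simp [hf0 _ y hyU] at hy

/-- A Lindelöf Čech-complete space maps properly to `[0, ∞)^ℕ`; properness is expressed as
compactness of the preimages of boxes. -/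
theorem IsCechComplete.exists_continuous_isCompact_box {X : Type*} [TopologicalSpace X]
    (hX : IsCechComplete X) [LindelofSpace X] :
    ∃ h : X → ℕ → ℝ, Continuous h ∧ (∀ x i, 0 ≤ h x i) ∧
      ∀ b : ℕ → ℝ, IsCompact {x | ∀ i, h x i ≤ b i} := by
  have := hX.t35Space
  obtain ⟨U, hUo, hU⟩ := isGδ_iff_eq_iInter_nat.1 hX.isGδ_range
  have hL : IsLindelof (range (stoneCechUnit : X → StoneCech X)) :=
    isLindelof_range continuous_stoneCechUnit
  choose g hgc hg0 hgpos hgU using fun n =>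
    hL.exists_continuous_pos_subset (hUo n) (hU ▸ iInter_subset U n)
  have hpos : ∀ x n, 0 < g n (stoneCechUnit x) := fun x n => hgpos n _ (mem_range_self x)
  refine ⟨fun x n => (g n (stoneCechUnit x))⁻¹, ?_, fun x n => (inv_pos.2 (hpos x n)).le,
    fun b => ?_⟩
  · exact continuous_pi fun n => ((hgc n).comp continuous_stoneCechUnit).inv₀
      fun x => (hpos x n).ne'
  · rw [isEmbedding_stoneCechUnit.isCompact_iff]
    have : stoneCechUnit '' {x : X | ∀ i, (g i (stoneCechUnit x))⁻¹ ≤ b i} =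
        {y | ∀ i, 1 ≤ b i * g i y} := by
      ext y
      constructor
      · rintro ⟨x, hx, rfl⟩ i
        exact (inv_le_iff_one_le_mul₀ (hpos x i)).1 (hx i)
      · intro hy
        have hypos : ∀ i, 0 < g i y := fun i => (hg0 i y).lt_of_ne fun h0 => by
          have := hy i
          rw [← h0, mul_zero] at this
          exact absurd this (by norm_num)
        obtain ⟨x, rfl⟩ : y ∈ range (stoneCechUnit : X → StoneCech X) :=
          hU ▸ mem_iInter.2 fun i => hgU i y (hypos i)
        exact ⟨x, fun i => (inv_le_iff_one_le_mul₀ (hpos x i)).2 (hy i), rfl⟩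
    rw [this]
    refine IsClosed.isCompact ?_
    simp only [ofPred_forall]
    exact isClosed_iInter fun i => isClosed_le continuous_const ((hgc i).const_mul _)

theorem exists_continuous_surjective_irrationals :
    ∃ f : (ℕ → ℕ) → Irrationals, Continuous f ∧ Function.Surjective f := by
  have hA := IsGδ.setOfPred_irrational.measurableSet.analyticSet
  rw [MeasureTheory.AnalyticSet] at hA
  obtain h | ⟨f, hf, hr⟩ := hA
  · exact absurd h (nonempty_iff_ne_empty.1 ⟨_, irrational_sqrt_two⟩)
  · refine ⟨fun φ => ⟨f φ, hr.subset (mem_range_self φ)⟩, hf.subtype_mk _, fun z => ?_⟩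
    obtain ⟨φ, hφ⟩ := hr.superset z.2
    exact ⟨φ, Subtype.ext hφ⟩

/-- If a Lindelöf Čech-complete space is not `σ`-compact, its product with `M` being Lindelöf forces
the product of `M` with the irrationals to be Lindelöf. -/
theorem IsCechComplete.lindelofSpace_prod_irrationals {X M : Type*} [TopologicalSpace X]
    [TopologicalSpace M] (hX : IsCechComplete X) [LindelofSpace X] (hσ : ¬ SigmaCompactSpace X)
    [LindelofSpace (X × M)] : LindelofSpace (M × Irrationals) := by
  obtain ⟨h, hc, h0, hbox⟩ := hX.exists_continuous_isCompact_box
  obtain ⟨R, hR, hsurj⟩ := exists_proper_relation hc h0 hbox hσ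
  have : LindelofSpace (R × M) := (hR.prodMap isProperMap_id).lindelofSpace
  obtain ⟨π, hπ, hπs⟩ := exists_continuous_surjective_irrationals
  refine LindelofSpace.of_continuous_surjective
    (f := fun p : R × M => (p.2, π p.1.1.2)) (by fun_prop) ?_
  rintro ⟨m, z⟩
  obtain ⟨φ, rfl⟩ := hπs z
  obtain ⟨p, rfl⟩ := hsurj φ
  exact ⟨(p, m), rfl⟩

theorem ProductivelyLindelof.lindelofSpace {X : Type u} [TopologicalSpace X]
    (hX : ProductivelyLindelof X) : LindelofSpace X := by
  have := hX PUnit inferInstance inferInstance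
  exact LindelofSpace.of_continuous_surjective (f := fun p : X × PUnit.{u + 1} => p.1)
    continuous_fst fun x => ⟨(x, ⟨⟩), rfl⟩

/-! ### The space of irrational numbers -/

/-- A space that embeds as a `Gδ` set into some compact Hausdorff space is Čech-complete: the
extension of the embedding to the Stone–Čech compactification maps the remainder into the
complement of the image. -/
theorem Topology.IsEmbedding.isCechComplete {X K : Type*} [TopologicalSpace X] [TopologicalSpace K]
    [CompactSpace K] [T2Space K] {f : X → K} (hf : IsEmbedding f) (hG : IsGδ (range f)) :
    IsCechComplete X := by
  have := hf.t35Space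
  refine ⟨this, ?_⟩
  have hF := continuous_stoneCechExtend hf.continuous
  have : range (stoneCechUnit : X → StoneCech X) =
      stoneCechExtend hf.continuous ⁻¹' range f := by
    ext y
    constructor
    · rintro ⟨x, rfl⟩
      exact ⟨x, (stoneCechExtend_stoneCechUnit hf.continuous x).symm⟩
    · rintro ⟨x, hx⟩
      refine ⟨x, ?_⟩
      have hne : (comap (stoneCechUnit : X → StoneCech X) (𝓝 y)).NeBot :=
        isDenseInducing_stoneCechUnit.comap_nhds_neBot y
      have h1 : Tendsto f (comap stoneCechUnit (𝓝 y)) (𝓝 (f x)) := by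
        simpa only [hx, Function.comp_def, stoneCechExtend_stoneCechUnit] using
          (hF.tendsto y).comp (tendsto_comap (f := stoneCechUnit))
      have h2 : Tendsto id (comap stoneCechUnit (𝓝 y)) (𝓝 x) := hf.tendsto_nhds_iff.2 h1
      exact tendsto_nhds_unique ((continuous_stoneCechUnit.tendsto x).comp h2) tendsto_comap
  rw [this]
  exact hG.preimage hF

/-- The compactification used is the extended real line, where the irrationals have countable
complement. -/
theorem isCechComplete_ulift_irrationals : IsCechComplete (ULift.{u} Irrationals) := by
  have hf : IsEmbedding fun z : ULift.{u} Irrationals => ((z.down : ℝ) : EReal) :=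
    EReal.isEmbedding_coe.comp (IsEmbedding.subtypeVal.comp IsEmbedding.uliftDown)
  refine hf.isCechComplete ?_
  have : range (fun z : ULift.{u} Irrationals => ((z.down : ℝ) : EReal)) =
      (insert ⊤ (insert ⊥ (range fun q : ℚ => ((q : ℝ) : EReal))))ᶜ := by
    ext y
    induction y with
    | bot => simp
    | top => simp
    | coe r => simp [Irrational]
  rw [this]
  exact (((countable_range _).insert _).insert _).isGδ_compl

/-- If the irrationals were `σ`-compact, the rationals would be a dense `Gδ` subset of the line
disjoint from the dense `Gδ` set of irrationals, against the Baire category theorem. -/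
theorem not_sigmaCompactSpace_irrationals : ¬ SigmaCompactSpace Irrationals := by
  intro hσ
  have hF : IsGδ {x : ℝ | Irrational x}ᶜ := by
    obtain ⟨K, hK, hKu⟩ := isSigmaCompact_range (continuous_subtype_val (p := Irrational))
    have hKu' : {x : ℝ | Irrational x} = ⋃ n, K n := by
      rw [hKu]
      exact Subtype.range_coe.symm
    rw [hKu', compl_iUnion]
    exact .iInter fun n => (hK n).isClosed.isOpen_compl.isGδ
  have hD : Dense {x : ℝ | Irrational x}ᶜ := Rat.isDenseEmbedding_coe_real.dense.mono
    fun x hx => not_not.2 hx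
  obtain ⟨x, hx, hx'⟩ := (dense_irrational.inter_of_Gδ .setOfPred_irrational hF hD).nonempty
  exact hx' hx

theorem mainTheorem2 :
    (∃ (M : Type u) (_ : TopologicalSpace M), IsMichaelSpace M) ↔
      ∀ (X : Type u) [TopologicalSpace X],
        ProductivelyLindelof X → IsCechComplete X → SigmaCompactSpace X := by
  constructor
  · rintro ⟨M, _, hM⟩ X _ hPL hX
    by_contra hσ
    have := hPL.lindelofSpace
    have := hPL M hM.t35Space hM.lindelofSpace
    exact hM.not_lindelofSpace_prod (hX.lindelofSpace_prod_irrationals hσ)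
  · intro H
    have hnPL : ¬ ProductivelyLindelof (ULift.{u} Irrationals) := fun hPL => by
      have := H _ hPL isCechComplete_ulift_irrationals
      refine not_sigmaCompactSpace_irrationals (isSigmaCompact_univ_iff.1 ?_)
      simpa [range_eq_univ.2 ULift.down_surjective] using
        isSigmaCompact_range (continuous_uliftDown (X := Irrationals))
    simp only [ProductivelyLindelof, not_forall] at hnPL
    obtain ⟨Y, _, hY, hYL, hnot⟩ := hnPL
    refine ⟨Y, _, hY, hYL, fun hL => hnot ?_⟩
    exact LindelofSpace.of_continuous_surjective
      (f := fun p : Y × Irrationals => (ULift.up.{u} p.2, p.1)) (by fun_prop)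
      fun q => ⟨(q.2, q.1.down), rfl⟩
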